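/- Let $0<q<1$. Write $(z;q)_\infty=\prod_{i=0}^{\infty}(1-zq^{i})$ for $z\in\mathbb{C}$, and let $$\Gamma_q(x)=\frac{(q;q)_\infty}{(q^{x};q)_\infty}\,(1-q)^{1-x}$$ denote the $q$-Gamma function. Let $m,n\in\mathbb{N}$ and let $\alpha_{k,1,\ell},\alpha_{k,2,\ell}>0$ be real numbers for $1\le k\le n$, $1\le\ell\le m$. Then the $n\times n$ matrix $$\left(\prod_{\ell=1}^{m}\frac{\Gamma_{q}(\alpha_{j,1,\ell}+\alpha_{k,1,\ell})\,\Gamma_{q}(\alpha_{j,2,\ell}+\alpha_{k,2,\ell})}{\Gamma_{q}(\alpha_{j,1,\ell}+\alpha_{j,2,\ell}+\alpha_{k,1,\ell}+\alpha_{k,2,\ell})}\right)_{j,k=1}^{n}$$ is positive semidefinite, that is, $\sum_{j,k=1}^{n}a_{j,k}z_j\overline{z_k}\ge 0$ for all $z_1,\dots,z_n\in\mathbb{C}$, where $a_{j,k}$ denotes its $(j,k)$ entry. -/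

import Mathlib

open scoped ComplexOrder

noncomputable section

/-- The infinite `q`-shifted factorial `(z; q)_∞ = ∏_{n ≥ 0} (1 - z q ^ n)`. -/
def qPochhammerInf (z : ℂ) (q : ℝ) : ℂ :=
  ∏' n : ℕ, (1 - z * (q : ℂ) ^ n)

/-- The `q`-Gamma function `Γ_q(z) = (q; q)_∞ / (q ^ z; q)_∞ * (1 - q) ^ (1 - z)`
for `0 < q < 1`. -/
def qGamma (q : ℝ) (z : ℂ) : ℂ :=
  qPochhammerInf (q : ℂ) q / qPochhammerInf ((q : ℂ) ^ z) q * (1 - (q : ℂ)) ^ (1 - z)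

end

/-!
For `‖u‖, ‖v‖ < 1`, the `q`-binomial theorem `∑ (a; q)_n / (q; q)_n u ^ n = (a u; q)_∞ / (u; q)_∞`
at `a = v` gives
`(u v; q)_∞ / ((u; q)_∞ (v; q)_∞) = ∑ u ^ n / ((q; q)_n (v q ^ n; q)_∞)`,
and at `a = 0` it expands each `1 / (v q ^ n; q)_∞` into powers of `v`. All coefficients are
nonnegative for `0 ≤ q < 1`, so by the Schur product theorem the left side is a positive
semidefinite kernel whenever `u` and `v` are. Up to a positive constant it is
`Γ_q(a) Γ_q(b) / Γ_q(a + b)` for `u = q ^ a`, `v = q ^ b`, and `q ^ (α_j + conj α_k)` is a kernel of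
rank one.
-/

open Filter Finset
open scoped Topology ComplexConjugate

/-- The finite `q`-shifted factorial `(a; q)_n`, whose limit in `n` is `(a; q)_∞`. -/
def qPochhammer {R : Type*} [CommRing R] (a q : R) (n : ℕ) : R :=
  ∏ i ∈ range n, (1 - a * q ^ i)

section CommRing

variable {R : Type*} [CommRing R]

@[simp]
lemma qPochhammer_zero (a q : R) : qPochhammer a q 0 = 1 :=
  prod_range_zero _

lemma qPochhammer_succ (a q : R) (n : ℕ) :
    qPochhammer a q (n + 1) = qPochhammer a q n * (1 - a * q ^ n) :=
  prod_range_succ _ _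

@[simp]
lemma qPochhammer_zero_left (q : R) (n : ℕ) : qPochhammer 0 q n = 1 := by
  simp [qPochhammer]

lemma qPochhammer_nonneg [PartialOrder R] [IsOrderedRing R] {a q : R} (ha : a ≤ 1) (hq₀ : 0 ≤ q)
    (hq₁ : q ≤ 1) (n : ℕ) : 0 ≤ qPochhammer a q n :=
  prod_nonneg fun i _ =>
    sub_nonneg.mpr (mul_le_one₀ ha (pow_nonneg hq₀ i) (pow_le_one₀ hq₀ hq₁))

end CommRing

section NormedField

variable {𝕜 : Type*} [NormedField 𝕜] {a q : 𝕜}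

lemma norm_mul_pow_le_norm (a : 𝕜) (hq : ‖q‖ ≤ 1) (n : ℕ) : ‖a * q ^ n‖ ≤ ‖a‖ := by
  rw [norm_mul, norm_pow]
  exact mul_le_of_le_one_right (norm_nonneg a) (pow_le_one₀ (norm_nonneg q) hq)

lemma one_sub_mul_pow_ne_zero (ha : ‖a‖ < 1) (hq : ‖q‖ ≤ 1) (n : ℕ) : 1 - a * q ^ n ≠ 0 := by
  intro h
  have : ‖(1 : 𝕜)‖ < 1 := sub_eq_zero.mp h ▸ (norm_mul_pow_le_norm a hq n).trans_lt ha
  exact this.ne norm_one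

lemma qPochhammer_ne_zero (ha : ‖a‖ < 1) (hq : ‖q‖ ≤ 1) (n : ℕ) : qPochhammer a q n ≠ 0 :=
  prod_ne_zero_iff.mpr fun i _ => one_sub_mul_pow_ne_zero ha hq i

lemma summable_norm_neg_mul_pow (a : 𝕜) (hq : ‖q‖ < 1) :
    Summable fun n : ℕ => ‖-(a * q ^ n)‖ := by
  simpa only [norm_neg, norm_mul, norm_pow] using
    (summable_geometric_of_lt_one (norm_nonneg q) hq).mul_left ‖a‖

variable [CompleteSpace 𝕜]

lemma multipliable_one_sub_mul_pow (a : 𝕜) (hq : ‖q‖ < 1) :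
    Multipliable fun n : ℕ => 1 - a * q ^ n := by
  simpa only [sub_eq_add_neg] using
    multipliable_one_add_of_summable (summable_norm_neg_mul_pow a hq)

lemma tendsto_qPochhammer (a : 𝕜) (hq : ‖q‖ < 1) :
    Tendsto (qPochhammer a q) atTop (𝓝 (∏' n : ℕ, (1 - a * q ^ n))) :=
  (multipliable_one_sub_mul_pow a hq).tendsto_prod_tprod_nat

lemma tprod_one_sub_mul_pow_ne_zero (ha : ‖a‖ < 1) (hq : ‖q‖ < 1) :
    ∏' n : ℕ, (1 - a * q ^ n) ≠ 0 := by
  simpa only [sub_eq_add_neg] using tprod_one_add_ne_zero_of_summable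
    (fun n => by simpa only [sub_eq_add_neg] using one_sub_mul_pow_ne_zero ha hq.le n)
    (summable_norm_neg_mul_pow a hq)

lemma qPochhammer_mul_tprod_one_sub_mul_pow (a : 𝕜) (hq : ‖q‖ < 1) (n : ℕ) :
    qPochhammer a q n * ∏' k : ℕ, (1 - a * q ^ n * q ^ k) = ∏' k : ℕ, (1 - a * q ^ k) := by
  have hshift (k : ℕ) : 1 - a * q ^ n * q ^ k = 1 - a * q ^ (k + n) := by ring
  simp only [hshift]
  refine Multipliable.prod_mul_tprod_nat_mul' (f := fun k => 1 - a * q ^ k) ?_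
  simpa only [hshift] using multipliable_one_sub_mul_pow (a * q ^ n) hq

end NormedField

section QBinomial

/-- The coefficient `(a; q)_n / (q; q)_n` of `z ^ n` in the `q`-binomial series. -/
def qBinomialCoeff {K : Type*} [Field K] (a q : K) (n : ℕ) : K :=
  qPochhammer a q n / qPochhammer q q n

@[simp]
lemma qBinomialCoeff_zero {K : Type*} [Field K] (a q : K) : qBinomialCoeff a q 0 = 1 := by
  simp [qBinomialCoeff]

variable {𝕜 : Type*} [NormedField 𝕜] {q z : 𝕜}

/-- The `q`-binomial series `∑ (a; q)_n / (q; q)_n z ^ n`, that is, the basic hypergeometric series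
`₁φ₀(a; q, z)`. -/
noncomputable def qBinomialSeries (a q z : 𝕜) : 𝕜 :=
  ∑' n, qBinomialCoeff a q n * z ^ n

lemma qBinomialCoeff_succ_mul (a : 𝕜) (hq : ‖q‖ < 1) (n : ℕ) :
    qBinomialCoeff a q (n + 1) * (1 - q ^ (n + 1)) = qBinomialCoeff a q n * (1 - a * q ^ n) := by
  have hfactor := one_sub_mul_pow_ne_zero hq hq.le n
  rw [qBinomialCoeff, qBinomialCoeff, qPochhammer_succ, qPochhammer_succ, pow_succ',
    ← div_mul_div_comm, mul_assoc, div_mul_cancel₀ _ hfactor]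

@[simp]
lemma qBinomialSeries_zero_right (a q : 𝕜) : qBinomialSeries a q 0 = 1 := by
  rw [qBinomialSeries, tsum_eq_single 0 fun n hn => by simp [hn]]
  simp

variable [CompleteSpace 𝕜]

lemma exists_norm_qBinomialCoeff_le (a : 𝕜) (hq : ‖q‖ < 1) :
    ∃ C, ∀ n, ‖qBinomialCoeff a q n‖ ≤ C := by
  have hlim : Tendsto (qBinomialCoeff a q) atTop _ :=
    (tendsto_qPochhammer a hq).div (tendsto_qPochhammer q hq) (tprod_one_sub_mul_pow_ne_zero hq hq)
  simpa using (Metric.isBounded_range_of_tendsto _ hlim).exists_norm_le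

lemma summable_norm_qBinomialCoeff_mul_pow (a : 𝕜) (hq : ‖q‖ < 1) (hz : ‖z‖ < 1) :
    Summable fun n => ‖qBinomialCoeff a q n * z ^ n‖ := by
  obtain ⟨C, hC⟩ := exists_norm_qBinomialCoeff_le a hq
  refine .of_nonneg_of_le (fun _ => norm_nonneg _) (fun n => ?_)
    ((summable_geometric_of_lt_one (norm_nonneg z) hz).mul_left C)
  rw [norm_mul, norm_pow]
  gcongr
  exact hC n

lemma hasSum_qBinomialSeries (a : 𝕜) (hq : ‖q‖ < 1) (hz : ‖z‖ < 1) :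
    HasSum (fun n => qBinomialCoeff a q n * z ^ n) (qBinomialSeries a q z) :=
  (summable_norm_qBinomialCoeff_mul_pow a hq hz).of_norm.hasSum

lemma one_sub_mul_qBinomialSeries (a : 𝕜) (hq : ‖q‖ < 1) (hz : ‖z‖ < 1) :
    (1 - z) * qBinomialSeries a q z = (1 - a * z) * qBinomialSeries a q (z * q) := by
  have hzq : ‖z * q‖ < 1 := by simpa using (norm_mul_pow_le_norm z hq.le 1).trans_lt hz
  have hf := hasSum_qBinomialSeries a hq hz
  have hg := hasSum_qBinomialSeries a hq hzq
  have hdiff : HasSum (fun n => qBinomialCoeff a q (n + 1) * (1 - q ^ (n + 1)) * z ^ (n + 1))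
      (qBinomialSeries a q z - qBinomialSeries a q (z * q)) := by
    have hfg : HasSum (fun n => qBinomialCoeff a q n * (1 - q ^ n) * z ^ n)
        (qBinomialSeries a q z - qBinomialSeries a q (z * q)) :=
      (hf.sub hg).congr_fun fun n => by ring
    simpa using (hasSum_nat_add_iff' 1).mpr hfg
  have hrec : HasSum (fun n => qBinomialCoeff a q (n + 1) * (1 - q ^ (n + 1)) * z ^ (n + 1))
      (z * qBinomialSeries a q z - a * z * qBinomialSeries a q (z * q)) :=
    ((hf.mul_left z).sub (hg.mul_left (a * z))).congr_fun fun n => by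
      rw [qBinomialCoeff_succ_mul a hq]
      ring
  linear_combination hdiff.unique hrec

lemma qPochhammer_mul_qBinomialSeries (a : 𝕜) (hq : ‖q‖ < 1) (hz : ‖z‖ < 1) (n : ℕ) :
    qPochhammer z q n * qBinomialSeries a q z =
      qPochhammer (a * z) q n * qBinomialSeries a q (z * q ^ n) := by
  induction n with
  | zero => simp
  | succ n ih =>
    have hstep :=
      one_sub_mul_qBinomialSeries a hq ((norm_mul_pow_le_norm z hq.le n).trans_lt hz)
    rw [mul_assoc z, ← pow_succ] at hstep
    rw [qPochhammer_succ, qPochhammer_succ]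
    linear_combination (1 - z * q ^ n) * ih + qPochhammer (a * z) q n * hstep

lemma tendsto_qBinomialSeries_mul_pow (a : 𝕜) (hq : ‖q‖ < 1) (hz : ‖z‖ < 1) :
    Tendsto (fun n : ℕ => qBinomialSeries a q (z * q ^ n)) atTop (𝓝 1) := by
  have hpow : Tendsto (fun n : ℕ => z * q ^ n) atTop (𝓝 0) := by
    simpa using (tendsto_pow_atTop_nhds_zero_of_norm_lt_one hq).const_mul z
  rw [← qBinomialSeries_zero_right a q]
  refine tendsto_tsum_of_dominated_convergence (summable_norm_qBinomialCoeff_mul_pow a hq hz)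
    (fun k => (hpow.pow k).const_mul _) (.of_forall fun n k => ?_)
  rw [norm_mul, norm_mul, norm_pow, norm_pow]
  gcongr
  exact norm_mul_pow_le_norm z hq.le n

theorem qBinomialSeries_eq_tprod_div_tprod (a : 𝕜) (hq : ‖q‖ < 1) (hz : ‖z‖ < 1) :
    qBinomialSeries a q z = (∏' n : ℕ, (1 - a * z * q ^ n)) / ∏' n : ℕ, (1 - z * q ^ n) := by
  rw [eq_div_iff (tprod_one_sub_mul_pow_ne_zero hz hq), mul_comm]
  have hleft := (tendsto_qPochhammer z hq).mul_const (qBinomialSeries a q z)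
  have hright := (tendsto_qPochhammer (a * z) hq).mul (tendsto_qBinomialSeries_mul_pow a hq hz)
  simp only [← qPochhammer_mul_qBinomialSeries a hq hz, mul_one] at hright
  exact tendsto_nhds_unique hleft hright

theorem hasSum_inv_tprod_one_sub_mul_pow (hq : ‖q‖ < 1) (hz : ‖z‖ < 1) :
    HasSum (fun n => (qPochhammer q q n)⁻¹ * z ^ n) (∏' n : ℕ, (1 - z * q ^ n))⁻¹ := by
  simpa [qBinomialSeries_eq_tprod_div_tprod 0 hq hz, qBinomialCoeff] using
    hasSum_qBinomialSeries 0 hq hz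

theorem hasSum_tprod_mul_div_tprod_mul_tprod {u v : 𝕜} (hq : ‖q‖ < 1) (hu : ‖u‖ < 1)
    (hv : ‖v‖ < 1) :
    HasSum (fun n => (qPochhammer q q n)⁻¹ * (u ^ n * (∏' k : ℕ, (1 - v * q ^ n * q ^ k))⁻¹))
      ((∏' k : ℕ, (1 - u * v * q ^ k)) /
        ((∏' k : ℕ, (1 - u * q ^ k)) * ∏' k : ℕ, (1 - v * q ^ k))) := by
  convert (hasSum_qBinomialSeries v hq hu).div_const (∏' k : ℕ, (1 - v * q ^ k)) using 1
  · ext n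
    have hn := qPochhammer_ne_zero hv hq.le n
    rw [← qPochhammer_mul_tprod_one_sub_mul_pow v hq n, qBinomialCoeff]
    field_simp
  · rw [qBinomialSeries_eq_tprod_div_tprod v hq hu, div_div, mul_comm v u]

end QBinomial

section PosSemidef

variable {ι : Type*}

section StarRing

variable {R : Type*} [Ring R] [PartialOrder R] [StarRing R]

lemma posSemidef_mul_star [StarOrderedRing R] (w : ι → R) :
    (Matrix.of fun j k => w j * star (w k)).PosSemidef := by
  refine ⟨.ext fun j k => by simp, fun x => ?_⟩
  convert mul_star_self_nonneg (x.sum fun j c => star c * w j) using 1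
  simp only [Finsupp.sum, star_sum, sum_mul_sum, star_mul, star_star, Matrix.of_apply, mul_assoc]

variable [TopologicalSpace R] [IsTopologicalSemiring R] [ContinuousStar R] [OrderClosedTopology R]

lemma posSemidef_of_tendsto {β : Type*} {l : Filter β} [l.NeBot] {A : β → Matrix ι ι R}
    {B : Matrix ι ι R} (hA : ∀ b, (A b).PosSemidef)
    (h : ∀ j k, Tendsto (fun b => A b j k) l (𝓝 (B j k))) : B.PosSemidef := by
  refine ⟨.ext fun j k => ?_, fun x => ?_⟩
  · exact tendsto_nhds_unique ((h k j).star.congr fun b => (hA b).isHermitian.apply j k) (h j k)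
  · refine ge_of_tendsto' (x := l) ?_ fun b => (hA b).2 x
    exact tendsto_finsetSum _ fun j _ => tendsto_finsetSum _ fun k _ =>
      ((h j k).const_mul _).mul_const _

lemma posSemidef_of_hasSum [AddLeftMono R] {β : Type*} {A : β → Matrix ι ι R} {B : Matrix ι ι R}
    (hA : ∀ b, (A b).PosSemidef) (h : ∀ j k, HasSum (fun b => A b j k) (B j k)) :
    B.PosSemidef :=
  posSemidef_of_tendsto (fun s => Matrix.posSemidef_sum s fun b _ => hA b) fun j k => by
    simpa only [Matrix.sum_apply, HasSum] using h j k

end StarRing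

variable {𝕜 : Type*} [RCLike 𝕜]

lemma posSemidef_hadamard_prod {κ : Type*} (s : Finset κ) {A : κ → ι → ι → 𝕜}
    (hA : ∀ i ∈ s, (Matrix.of (A i)).PosSemidef) :
    (Matrix.of fun j k => ∏ i ∈ s, A i j k).PosSemidef := by
  classical
  induction s using Finset.induction_on with
  | empty => simpa using posSemidef_mul_star (1 : ι → 𝕜)
  | insert i s hi ih =>
    simp only [prod_insert hi]
    exact (hA i (mem_insert_self i s)).hadamard (ih fun i' hi' => hA i' (mem_insert_of_mem hi'))

lemma posSemidef_hadamard_pow {A : Matrix ι ι 𝕜} (hA : A.PosSemidef) (n : ℕ) :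
    (Matrix.of fun j k => A j k ^ n).PosSemidef := by
  simpa using posSemidef_hadamard_prod (range n) fun _ _ => hA

end PosSemidef

section QBeta

variable {ι : Type*} {q : ℝ}

lemma qPochhammer_ofReal_self_nonneg (hq₀ : 0 ≤ q) (hq₁ : q ≤ 1) (n : ℕ) :
    0 ≤ qPochhammer (q : ℂ) q n :=
  have hq : (q : ℂ) ≤ 1 := mod_cast hq₁
  qPochhammer_nonneg hq (mod_cast hq₀) hq n

lemma qPochhammerInf_self_nonneg (hq₀ : 0 ≤ q) (hq₁ : q < 1) : 0 ≤ qPochhammerInf q q :=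
  ge_of_tendsto' (tendsto_qPochhammer _ ((Complex.norm_of_nonneg hq₀).trans_lt hq₁))
    (qPochhammer_ofReal_self_nonneg hq₀ hq₁.le)

lemma posSemidef_inv_qPochhammerInf (hq₀ : 0 ≤ q) (hq₁ : q < 1) {A : Matrix ι ι ℂ}
    (hA : A.PosSemidef) (hA₁ : ∀ j k, ‖A j k‖ < 1) :
    (Matrix.of fun j k => (qPochhammerInf (A j k) q)⁻¹).PosSemidef :=
  have hq : ‖(q : ℂ)‖ < 1 := (Complex.norm_of_nonneg hq₀).trans_lt hq₁
  posSemidef_of_hasSum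
    (fun n => (posSemidef_hadamard_pow hA n).smul
      (inv_nonneg.mpr (qPochhammer_ofReal_self_nonneg hq₀ hq₁.le n)))
    fun j k => hasSum_inv_tprod_one_sub_mul_pow hq (hA₁ j k)

lemma posSemidef_qPochhammerInf_mul_div (hq₀ : 0 ≤ q) (hq₁ : q < 1) {A B : Matrix ι ι ℂ}
    (hA : A.PosSemidef) (hB : B.PosSemidef) (hA₁ : ∀ j k, ‖A j k‖ < 1)
    (hB₁ : ∀ j k, ‖B j k‖ < 1) :
    (Matrix.of fun j k => qPochhammerInf (A j k * B j k) q /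
      (qPochhammerInf (A j k) q * qPochhammerInf (B j k) q)).PosSemidef := by
  have hq : ‖(q : ℂ)‖ < 1 := (Complex.norm_of_nonneg hq₀).trans_lt hq₁
  have hBpow (n : ℕ) :
      (Matrix.of fun j k => (qPochhammerInf (B j k * (q : ℂ) ^ n) q)⁻¹).PosSemidef := by
    have hqpow : (0 : ℂ) ≤ (q : ℂ) ^ n := pow_nonneg (mod_cast hq₀) n
    refine posSemidef_inv_qPochhammerInf hq₀ hq₁
      (A := Matrix.of fun j k => B j k * (q : ℂ) ^ n) ?_
      fun j k => (norm_mul_pow_le_norm _ hq.le n).trans_lt (hB₁ j k)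
    convert hB.smul hqpow using 1
    ext j k
    simp [mul_comm]
  exact posSemidef_of_hasSum
    (fun n => ((posSemidef_hadamard_pow hA n).hadamard (hBpow n)).smul
      (inv_nonneg.mpr (qPochhammer_ofReal_self_nonneg hq₀ hq₁.le n)))
    fun j k => hasSum_tprod_mul_div_tprod_mul_tprod hq (hA₁ j k) (hB₁ j k)

/-- The `q`-Beta function `B_q(a, b) = Γ_q(a) Γ_q(b) / Γ_q(a + b)`. -/
noncomputable def qBeta (q : ℝ) (a b : ℂ) : ℂ :=
  qGamma q a * qGamma q b / qGamma q (a + b)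

lemma qBeta_eq_qPochhammerInf (hq₀ : q ≠ 0) (hq₁ : q ≠ 1) (a b : ℂ) :
    qBeta q a b = (1 - (q : ℂ)) * qPochhammerInf q q *
      (qPochhammerInf ((q : ℂ) ^ a * (q : ℂ) ^ b) q /
        (qPochhammerInf ((q : ℂ) ^ a) q * qPochhammerInf ((q : ℂ) ^ b) q)) := by
  have hq : (q : ℂ) ≠ 0 := mod_cast hq₀
  have hq' : 1 - (q : ℂ) ≠ 0 := sub_ne_zero.mpr (mod_cast hq₁.symm)
  have hpow : (1 - (q : ℂ)) ^ (1 - a) * (1 - (q : ℂ)) ^ (1 - b) / (1 - (q : ℂ)) ^ (1 - (a + b)) =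
      1 - q := by
    rw [← Complex.cpow_add _ _ hq', ← Complex.cpow_sub _ _ hq']
    ring_nf
    exact Complex.cpow_one _
  rw [← hpow, ← mul_self_div_self (qPochhammerInf q q), qBeta, qGamma, qGamma, qGamma,
    Complex.cpow_add _ _ hq]
  simp only [div_eq_mul_inv, mul_inv, inv_inv]
  ring

lemma posSemidef_cpow_add_conj (hq₀ : 0 < q) (c : ι → ℂ) :
    (Matrix.of fun j k => (q : ℂ) ^ (c j + conj (c k))).PosSemidef := by
  have hentry (j k : ι) : (q : ℂ) ^ (c j + conj (c k)) = q ^ c j * star ((q : ℂ) ^ c k) := by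
    have harg : (q : ℂ).arg ≠ Real.pi := by
      simpa [Complex.arg_ofReal_of_nonneg hq₀.le] using Real.pi_ne_zero.symm
    rw [Complex.cpow_add _ _ (mod_cast hq₀.ne'), Complex.cpow_conj _ _ harg, Complex.conj_ofReal,
      starRingEnd_apply]
  simp only [hentry]
  exact posSemidef_mul_star fun j => (q : ℂ) ^ c j

lemma norm_cpow_add_conj_lt_one (hq₀ : 0 < q) (hq₁ : q < 1) {c d : ℂ} (hc : 0 < c.re)
    (hd : 0 < d.re) : ‖(q : ℂ) ^ (c + conj d)‖ < 1 := by
  rw [Complex.norm_cpow_eq_rpow_re_of_pos hq₀]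
  exact Real.rpow_lt_one hq₀.le hq₁ (by simpa using add_pos hc hd)

lemma posSemidef_qBeta (hq₀ : 0 < q) (hq₁ : q < 1) {a b : ι → ℂ} (ha : ∀ k, 0 < (a k).re)
    (hb : ∀ k, 0 < (b k).re) :
    (Matrix.of fun j k => qBeta q (a j + conj (a k)) (b j + conj (b k))).PosSemidef := by
  have hconst : 0 ≤ (1 - (q : ℂ)) * qPochhammerInf q q :=
    mul_nonneg (sub_nonneg.mpr (mod_cast hq₁.le)) (qPochhammerInf_self_nonneg hq₀.le hq₁)
  simp only [qBeta_eq_qPochhammerInf hq₀.ne' hq₁.ne]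
  exact (posSemidef_qPochhammerInf_mul_div hq₀.le hq₁ (posSemidef_cpow_add_conj hq₀ a)
    (posSemidef_cpow_add_conj hq₀ b) (fun j k => norm_cpow_add_conj_lt_one hq₀ hq₁ (ha j) (ha k))
    fun j k => norm_cpow_add_conj_lt_one hq₀ hq₁ (hb j) (hb k)).smul hconst

end QBeta

theorem mainTheorem8_general {ι κ : Type*} [Fintype κ] {q : ℝ} (hq₀ : 0 < q) (hq₁ : q < 1)
    (α₁ α₂ : ι → κ → ℂ) (hα₁ : ∀ k l, 0 < (α₁ k l).re) (hα₂ : ∀ k l, 0 < (α₂ k l).re) :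
    (Matrix.of fun j k : ι =>
      ∏ l : κ, qGamma q (α₁ j l + conj (α₁ k l)) * qGamma q (α₂ j l + conj (α₂ k l)) /
        qGamma q (α₁ j l + α₂ j l + conj (α₁ k l) + conj (α₂ k l))).PosSemidef := by
  have harg (j k : ι) (l : κ) : α₁ j l + α₂ j l + conj (α₁ k l) + conj (α₂ k l) =
      (α₁ j l + conj (α₁ k l)) + (α₂ j l + conj (α₂ k l)) := by ring
  simp only [harg]
  exact posSemidef_hadamard_prod univ fun l _ =>
    posSemidef_qBeta hq₀ hq₁ (fun k => hα₁ k l) fun k => hα₂ k l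

theorem mainTheorem8 (q : ℝ) (hq0 : 0 < q) (hq1 : q < 1) (m n : ℕ)
    (α₁ α₂ : Fin n → Fin m → ℝ)
    (hα₁ : ∀ k l, 0 < α₁ k l) (hα₂ : ∀ k l, 0 < α₂ k l) :
    (Matrix.of fun j k : Fin n =>
      ∏ l : Fin m,
        qGamma q (α₁ j l + α₁ k l) * qGamma q (α₂ j l + α₂ k l) /
          qGamma q (α₁ j l + α₂ j l + α₁ k l + α₂ k l)).PosSemidef := by
  simpa only [Complex.conj_ofReal] using
    mainTheorem8_general hq0 hq1 (fun k l => (α₁ k l : ℂ)) (fun k l => (α₂ k l : ℂ)) hα₁ hα₂
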